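/- Let $P\in\mathbb R^{d\times n}$ have $\mathbb Q$-linearly independent columns, and let $\mathbb T^n=(\mathbb R/2\pi\mathbb Z)^n$ carry the normalized measure $(2\pi)^{-n}\,d\boldsymbol y$. For $r\in\mathbb R$ let $\overline H^{r}_{P,0}(\mathbb T^n)$ be the space of formal Fourier series $U=\sum_{\boldsymbol k\in\mathbb Z^n\setminus\{0\}}\widehat U_{\boldsymbol k}e^{i\boldsymbol k^\top \boldsymbol y}$, $\widehat U_{\boldsymbol k}\in\mathbb C$, with $\sum_{\boldsymbol k\ne 0}|P\boldsymbol k|^{2r}|\widehat U_{\boldsymbol k}|^2<\infty$, where $|\cdot|$ is the Euclidean norm. Let $A:\mathbb T^n\to\mathbb R$ be measurable with $0<\alpha_0\le A(\boldsymbol y)\le\alpha_1<\infty$ for all $\boldsymbol y$. Let $s\ge 0$ be real and suppose that, for some real $N>n+s+1$ and some constant $C_A>0$, the Fourier coefficients of $A$ satisfy $|\widehat A_{\boldsymbol k}|\le C_A(1+|\boldsymbol k|)^{-N}$ for all $\boldsymbol k\in\mathbb Z^n$. If $F\in\overline H^{-1}_{P,0}(\mathbb T^n)\cap\overline H^{s}_{P,0}(\mathbb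 T^n)$, then the variational problem: find $U\in\overline H^{1}_{P,0}(\mathbb T^n)$ such that $$(AP\nabla U,P\nabla V)_{L^2(\mathbb T^n)^d}=\langle F,V\rangle:=\sum_{\boldsymbol k\ne 0}\widehat F_{\boldsymbol k}\overline{\widehat V_{\boldsymbol k}}\qquad\text{for all }V\in\overline H^{1}_{P,0}(\mathbb T^n),$$ has a unique solution $U$, and $U\in\overline H^{s+2}_{P,0}(\mathbb T^n)$. Here $P\nabla U\in L^2(\mathbb T^n)^d$ is the vector field with Fourier coefficients $i\,(P\boldsymbol k)\,\widehat U_{\boldsymbol k}$. -/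

import Mathlib

open scoped ComplexConjugate
open MeasureTheory

noncomputable section

/-- The torus `𝕋ⁿ = (ℝ / 2πℤ)ⁿ`. -/
abbrev Torus (n : ℕ) : Type := Fin n → AddCircle (2 * Real.pi)

instance fact_two_pi_pos : Fact (0 < 2 * Real.pi) := ⟨Real.two_pi_pos⟩

/-- The normalized Haar measure `(2π)⁻ⁿ dy` on `𝕋ⁿ`, for which the inner product of `L²(𝕋ⁿ)` is
`∑ₖ Ûₖ conj V̂ₖ`. -/
def torusMeasure (n : ℕ) : Measure (Torus n) :=
  Measure.pi fun _ => AddCircle.haarAddCircle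

instance torusMeasure_isProbabilityMeasure (n : ℕ) : IsProbabilityMeasure (torusMeasure n) := by
  unfold torusMeasure; infer_instance

/-- The character `y ↦ exp(i kᵀy) = ∏ⱼ exp(i kⱼ yⱼ)` on `𝕋ⁿ`. -/
def torusChar {n : ℕ} (k : Fin n → ℤ) : C(Torus n, ℂ) where
  toFun y := ∏ j, fourier (k j) (y j)
  continuous_toFun := by fun_prop

/-- The Fourier coefficient `Âₖ = (2π)⁻ⁿ ∫ A(y) exp(-i kᵀy) dy` of a real function on `𝕋ⁿ`. -/
def torusFourierCoeff {n : ℕ} (A : Torus n → ℝ) (k : Fin n → ℤ) : ℂ :=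
  ∫ y, (A y : ℂ) * conj (torusChar k y) ∂torusMeasure n

/-- A formal Fourier series `∑ₖ cₖ exp(i kᵀy)` on `𝕋ⁿ`, given by its coefficients `cₖ ∈ ℂ`. -/
abbrev FourierSeries (n : ℕ) : Type := (Fin n → ℤ) → ℂ

/-- The `L²(𝕋ⁿ)` function with the given (square summable) Fourier coefficients: the sum of the
Fourier series in `L²(𝕋ⁿ)`. -/
def FourierSeries.toL2 {n : ℕ} (c : FourierSeries n) : Lp ℂ 2 (torusMeasure n) :=
  ∑' k, c k • ContinuousMap.toLp 2 (torusMeasure n) ℂ (torusChar k)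

/-- The integer frequency `k`, as a vector of Euclidean `ℝⁿ`. -/
def freq {n : ℕ} (k : Fin n → ℤ) : EuclideanSpace ℝ (Fin n) :=
  WithLp.toLp 2 fun j => (k j : ℝ)

/-- The projected frequency `P k`, as a vector of Euclidean `ℝᵈ`. -/
def projFreq {d n : ℕ} (P : Matrix (Fin d) (Fin n) ℝ) (k : Fin n → ℤ) :
    EuclideanSpace ℝ (Fin d) :=
  WithLp.toLp 2 (P.mulVec fun j => (k j : ℝ))

/-- `P` is a projection matrix: its columns are linearly independent over `ℚ`. -/
def IsProjectionMatrix {d n : ℕ} (P : Matrix (Fin d) (Fin n) ℝ) : Prop :=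
  LinearIndependent ℚ fun j : Fin n => P.col j

/-- The zero-mean homogeneous `P`-projected Sobolev space of real order `s`: the formal Fourier
series with `Û₀ = 0` and `∑_{k ≠ 0} |P k|^{2s} |Ûₖ|² < ∞`. -/
def HbarP0 {d n : ℕ} (P : Matrix (Fin d) (Fin n) ℝ) (s : ℝ) : Submodule ℂ (FourierSeries n) where
  carrier := {U | U 0 = 0 ∧
    Summable fun k : {k : Fin n → ℤ // k ≠ 0} => ‖projFreq P k‖ ^ (2 * s) * ‖U k‖ ^ 2}
  zero_mem' := by simp [summable_zero]
  add_mem' := by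
    rintro U V ⟨hU0, hU⟩ ⟨hV0, hV⟩
    refine ⟨by simp [hU0, hV0], ?_⟩
    refine Summable.of_nonneg_of_le (fun k => by positivity) (fun k => ?_)
      ((hU.add hV).mul_left 2)
    have h1 : ‖U k + V k‖ ^ 2 ≤ 2 * (‖U k‖ ^ 2 + ‖V k‖ ^ 2) := by
      have := norm_add_le (U k) (V k)
      nlinarith [norm_nonneg (U k + V k), sq_nonneg (‖U k‖ - ‖V k‖)]
    have h2 : 0 ≤ ‖projFreq P k‖ ^ (2 * s) := by positivity
    have := mul_le_mul_of_nonneg_left h1 h2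
    simp only [Pi.add_apply]
    linarith
  smul_mem' := by
    rintro a U ⟨hU0, hU⟩
    refine ⟨by simp [hU0], ?_⟩
    refine (hU.mul_left (‖a‖ ^ 2)).congr fun k => ?_
    simp only [Pi.smul_apply, smul_eq_mul, norm_mul]
    ring

/-- The `j`-th component of `P∇U`, whose Fourier coefficients are `i (P k)ⱼ Ûₖ`. -/
def projGrad {d n : ℕ} (P : Matrix (Fin d) (Fin n) ℝ) (U : FourierSeries n) (j : Fin d) :
    FourierSeries n :=
  fun k => Complex.I * (projFreq P k j : ℂ) * U k

/-- The form `a(U, V) = (A P∇U, P∇V)`, with the inner product of `L²(𝕋ⁿ)ᵈ`. -/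
def ellipticForm {d n : ℕ} (P : Matrix (Fin d) (Fin n) ℝ) (A : Torus n → ℝ)
    (U V : FourierSeries n) : ℂ :=
  ∑ j : Fin d, ∫ y, (A y : ℂ) * (projGrad P U j).toL2 y * conj ((projGrad P V j).toL2 y)
    ∂torusMeasure n

/-- The duality pairing `⟨F, V⟩ = ∑_{k ≠ 0} F̂ₖ conj V̂ₖ`. -/
def dualPairing {n : ℕ} (F V : FourierSeries n) : ℂ :=
  ∑' k : {k : Fin n → ℤ // k ≠ 0}, F k * conj (V k)

/-- `U` is a variational solution: `U` lies in the energy space (order `1`) and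
`a(U, V) = ⟨F, V⟩` for all `V` in the energy space. -/
def IsVariationalSolution {d n : ℕ} (P : Matrix (Fin d) (Fin n) ℝ) (A : Torus n → ℝ)
    (F U : FourierSeries n) : Prop :=
  U ∈ HbarP0 P 1 ∧ ∀ V ∈ HbarP0 P 1, ellipticForm P A U V = dualPairing F V

/-- The Fourier coefficients of `A` decay at the rate `N`:
`|Âₖ| ≤ C (1 + |k|)^{-N}` for all `k`, with a constant `C > 0`. -/
def HasFourierDecay {n : ℕ} (A : Torus n → ℝ) (N : ℝ) : Prop :=
  ∃ C : ℝ, 0 < C ∧ ∀ k : Fin n → ℤ, ‖torusFourierCoeff A k‖ ≤ C * (1 + ‖freq k‖) ^ (-N)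

end

/-! ### Real powers -/

/-! Rational independence gives `P k ≠ 0` for `k ≠ 0`, so `w k = |P k| U k` identifies the energy
space with `ℓ²` over the nonzero frequencies. There the problem reads `B w = f` with `f k = F k / |P
k|`, and `B` has entries `⟨P k, P l⟩ / (|P k| |P l|)` times `Â (k - l)`. It compresses
multiplication by `A` (`exists_ellipticOperator`), hence is coercive with constant `α₀`, and
Lax–Milgram solves the equation uniquely.

Regularity means passing from `|P k|^(s+1) f ∈ ℓ²` to `|P k|^(s+1) w ∈ ℓ²`. With the bounded weight
`m = min(|P k|, M)^(s+1)`, coercivity at `m w` leaves `⟨m w, m f⟩` and the commutator `[m, B]`. The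
entries of the latter are at most `κ (k - l) (min(|P l|, M)^s + 1)` with `κ` summable, because `N -
(s+1) > n` (`exists_commutator_kernel`). Schur's test and interpolation absorb this term uniformly
in `M` (`summable_weighted_of_apply`), and `M` is then removed. No lower bound on `|P k|` is needed.
-/

theorem rpow_sub_rpow_le_mul {x y σ : ℝ} (hx : 0 ≤ x) (hxy : x ≤ y) (hσ : 1 ≤ σ) :
    y ^ σ - x ^ σ ≤ σ * (y - x) * y ^ (σ - 1) := by
  rcases (hx.trans hxy).eq_or_lt with rfl | hy
  · obtain rfl : x = 0 := le_antisymm hxy hx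
    simp
  -- Bernoulli's inequality for the ratio `x / y`, to be multiplied by `y ^ σ`.
  have h := one_add_mul_self_le_rpow_one_add (s := x / y - 1)
    (by have : 0 ≤ x / y := by positivity
        linarith) hσ
  rw [add_sub_cancel, Real.div_rpow hx hy.le, le_div_iff₀ (by positivity)] at h
  have h2 : y ^ σ = y * y ^ (σ - 1) := by
    rw [← Real.rpow_one_add' hy.le (by linarith)]; ring_nf
  have h3 : (1 + σ * (x / y - 1)) * y ^ σ = y ^ σ - σ * (y - x) * y ^ (σ - 1) := by
    rw [h2]; field_simp; ring
  linarith

theorem max_rpow_le_add {x y s : ℝ} (hx : 0 ≤ x) (hy : 0 ≤ y) (hs : 0 ≤ s) :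
    max x y ^ s ≤ 2 ^ s * (y ^ s + |x - y| ^ s) := by
  have h : max x y ≤ 2 * max y |x - y| := by
    apply max_le
    · have := le_abs_self (x - y)
      have := le_max_left y |x - y|
      have := le_max_right y |x - y|
      linarith
    · have := le_max_left y |x - y|
      linarith
  have h2 : max y |x - y| ^ s ≤ y ^ s + |x - y| ^ s := by
    rcases max_choice y |x - y| with h | h <;> rw [h]
    · have : 0 ≤ |x - y| ^ s := by positivity
      linarith
    · have : 0 ≤ y ^ s := by positivity
      linarith
  calc max x y ^ s ≤ (2 * max y |x - y|) ^ s := by gcongr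
    _ = 2 ^ s * max y |x - y| ^ s := by
      rw [Real.mul_rpow (by norm_num) (le_max_of_le_left hy)]
    _ ≤ _ := by gcongr

/-- A mean value bound: the difference loses one power. Eliminating `max x y` leaves only `y` and `x
- y`, as a convolution estimate requires. -/
theorem abs_rpow_sub_rpow_le {x y s : ℝ} (hx : 0 ≤ x) (hy : 0 ≤ y) (hs : 0 ≤ s) :
    |x ^ (s + 1) - y ^ (s + 1)| ≤
      (s + 1) * 2 ^ s * (|x - y| * (y ^ s + |x - y| ^ s)) := by
  have key : |x ^ (s + 1) - y ^ (s + 1)| ≤ (s + 1) * |x - y| * max x y ^ s := by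
    rcases le_total x y with h | h
    · have := rpow_sub_rpow_le_mul hx h (σ := s + 1) (by linarith)
      rw [add_sub_cancel_right] at this
      rw [max_eq_right h, abs_sub_comm, abs_sub_comm x y, abs_of_nonneg (sub_nonneg.2 h),
        abs_of_nonneg (sub_nonneg.2 (by gcongr))]
      exact this
    · have := rpow_sub_rpow_le_mul hy h (σ := s + 1) (by linarith)
      rw [add_sub_cancel_right] at this
      rw [max_eq_left h, abs_of_nonneg (sub_nonneg.2 h),
        abs_of_nonneg (sub_nonneg.2 (by gcongr))]
      exact this
  calc _ ≤ (s + 1) * |x - y| * max x y ^ s := key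
    _ ≤ (s + 1) * |x - y| * (2 ^ s * (y ^ s + |x - y| ^ s)) := by
      gcongr; exact max_rpow_le_add hx hy hs
    _ = _ := by ring

/-- Interpolation: a lower power is a small multiple of a higher one plus a constant. -/
theorem exists_sq_rpow_add_one_le {s δ : ℝ} (hs : 0 ≤ s) (hδ : 0 < δ) :
    ∃ C : ℝ, 0 ≤ C ∧ ∀ x : ℝ, 0 ≤ x → (x ^ s + 1) ^ 2 ≤ δ * (x ^ (s + 1)) ^ 2 + C := by
  obtain ⟨R, hR, hRδ⟩ : ∃ R : ℝ, 1 ≤ R ∧ 4 ≤ δ * R ^ 2 := by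
    -- Beyond `R ≥ 1` one has `x ^ s + 1 ≤ 2 x ^ s`, and the extra factor `δ x ^ 2 ≥ 4` pays for the
    -- square.
    refine ⟨max 1 (4 / δ), le_max_left _ _, ?_⟩
    have h1 := le_max_left 1 (4 / δ)
    have h2 : 4 ≤ δ * max 1 (4 / δ) := by
      have := le_max_right 1 (4 / δ)
      rw [div_le_iff₀ hδ] at this
      linarith
    nlinarith
  refine ⟨(R ^ s + 1) ^ 2, by positivity, fun x hx => ?_⟩
  rcases le_total x R with h | h
  · have : (x ^ s + 1) ^ 2 ≤ (R ^ s + 1) ^ 2 := by gcongr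
    have : 0 ≤ δ * (x ^ (s + 1)) ^ 2 := by positivity
    linarith
  · have hx1 : 1 ≤ x := hR.trans h
    have h1 : 1 ≤ x ^ s := Real.one_le_rpow hx1 hs
    have h2 : x ^ (s + 1) = x ^ s * x := Real.rpow_add_one (by linarith) s
    have h3 : (x ^ s + 1) ^ 2 ≤ 4 * (x ^ s) ^ 2 := by nlinarith
    have h4 : 4 * (x ^ s) ^ 2 ≤ δ * x ^ 2 * (x ^ s) ^ 2 := by
      gcongr
      calc (4 : ℝ) ≤ δ * R ^ 2 := hRδ
        _ ≤ _ := by gcongr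
    have h5 : 0 ≤ (R ^ s + 1) ^ 2 := by positivity
    rw [h2]
    nlinarith

/-! ### Summation over integer frequencies -/

theorem summable_one_add_norm_freq_rpow {n : ℕ} {r : ℝ} (hr : (n : ℝ) < r) :
    Summable fun k : Fin n → ℤ => (1 + ‖freq k‖) ^ (-r) := by
  classical
  let b := (EuclideanSpace.basisFun (Fin n) ℝ).toBasis
  let L : Submodule ℤ (EuclideanSpace ℝ (Fin n)) := Submodule.span ℤ (Set.range b)
  have hrank : Module.finrank ℤ L = n := by
    rw [Module.finrank_eq_card_basis (b.restrictScalars ℤ), Fintype.card_fin]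
  have hmem (k : Fin n → ℤ) : freq k ∈ L := by
    have : freq k = ∑ j, k j • b j := by
      ext i
      simp [freq, b, EuclideanSpace.basisFun_apply, Finset.sum_apply, Pi.single_apply]
    rw [this]
    exact Submodule.sum_mem _ fun j _ =>
      Submodule.smul_mem _ _ (Submodule.subset_span (Set.mem_range_self j))
  have hsum := ZLattice.summable_norm_rpow L (-r) (by rw [hrank]; linarith)
  have hinj : Function.Injective fun k : Fin n → ℤ => (⟨freq k, hmem k⟩ : L) := by
    intro k l hkl
    have := congrArg (fun z : L => (z : EuclideanSpace ℝ (Fin n))) hkl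
    ext i
    have h := congrArg (fun z : EuclideanSpace ℝ (Fin n) => z i) this
    simpa [freq] using h
  -- The comparison fails only at `k = 0`, where `0 ^ (-r) = 0`.
  refine Summable.of_norm_bounded_eventually (hsum.comp_injective hinj) ?_
  refine (Set.finite_singleton (0 : Fin n → ℤ)).subset fun k hk => ?_
  by_contra hk0
  apply hk
  have hpos : 0 < ‖freq k‖ := by
    rw [norm_pos_iff]
    intro h
    apply hk0
    ext i
    have h := congrArg (fun z : EuclideanSpace ℝ (Fin n) => z i) h
    simpa [freq] using h
  change ‖(1 + ‖freq k‖) ^ (-r)‖ ≤ ‖freq k‖ ^ (-r)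
  rw [Real.norm_of_nonneg (by positivity)]
  exact Real.rpow_le_rpow_of_nonpos hpos (by linarith) (by
    have : (0 : ℝ) ≤ n := Nat.cast_nonneg n
    linarith)

/-! ### Schur's test for convolution kernels -/

section Schur

variable {G ι : Type*} [AddCommGroup G] {κ : G → ℝ} {j : ι → G}

/-- The map `(a, b) ↦ (a, j a - j b)` is injective, so this is a subsum of a product of two sums.
The embedding `j` allows index sets that are not groups, such as the nonzero frequencies. -/
theorem summable_conv_left (hκ : Summable κ) (hκ0 : ∀ g, 0 ≤ κ g) (hj : Function.Injective j)
    {z : ι → ℝ} (hz : Summable z) (hz0 : ∀ i, 0 ≤ z i) :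
    Summable (fun q : ι × ι => z q.1 * κ (j q.1 - j q.2)) ∧
      ∑' q : ι × ι, z q.1 * κ (j q.1 - j q.2) ≤ (∑' i, z i) * ∑' g, κ g := by
  have hinj : Function.Injective fun q : ι × ι => (q.1, j q.1 - j q.2) := by
    rintro ⟨a, b⟩ ⟨c, d⟩ h
    simp only [Prod.mk.injEq] at h
    obtain ⟨rfl, h⟩ := h
    rw [sub_right_inj] at h
    rw [hj h]
  have hs : Summable fun q : ι × G => z q.1 * κ q.2 := hz.mul_of_nonneg hκ hz0 hκ0
  refine ⟨hs.comp_injective hinj, ?_⟩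
  rw [hz.tsum_mul_tsum hκ hs]
  exact tsum_comp_le_tsum_of_inj hs (fun q => mul_nonneg (hz0 _) (hκ0 _)) hinj

theorem summable_conv_right (hκ : Summable κ) (hκ0 : ∀ g, 0 ≤ κ g) (hj : Function.Injective j)
    {z : ι → ℝ} (hz : Summable z) (hz0 : ∀ i, 0 ≤ z i) :
    Summable (fun q : ι × ι => z q.2 * κ (j q.1 - j q.2)) ∧
      ∑' q : ι × ι, z q.2 * κ (j q.1 - j q.2) ≤ (∑' i, z i) * ∑' g, κ g := by
  have hinj : Function.Injective fun q : ι × ι => (q.2, j q.1 - j q.2) := by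
    rintro ⟨a, b⟩ ⟨c, d⟩ h
    simp only [Prod.mk.injEq] at h
    obtain ⟨rfl, h⟩ := h
    rw [sub_left_inj] at h
    rw [hj h]
  have hs : Summable fun q : ι × G => z q.1 * κ q.2 := hz.mul_of_nonneg hκ hz0 hκ0
  refine ⟨hs.comp_injective hinj, ?_⟩
  rw [hz.tsum_mul_tsum hκ hs]
  exact tsum_comp_le_tsum_of_inj hs (fun q => mul_nonneg (hz0 _) (hκ0 _)) hinj

/-- Weighted AM–GM on `x * y` reduces to the two one-sided sums; the free `t` lets the `y` part be
absorbed later. -/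
theorem summable_conv_mul (hκ : Summable κ) (hκ0 : ∀ g, 0 ≤ κ g) (hj : Function.Injective j)
    {x y : ι → ℝ} (hx : Summable fun i => x i ^ 2) (hy : Summable fun i => y i ^ 2)
    (hx0 : ∀ i, 0 ≤ x i) (hy0 : ∀ i, 0 ≤ y i) {t : ℝ} (ht : 0 < t) :
    Summable (fun q : ι × ι => κ (j q.1 - j q.2) * x q.2 * y q.1) ∧
      ∑' q : ι × ι, κ (j q.1 - j q.2) * x q.2 * y q.1 ≤
        (∑' g, κ g) * (t * ∑' i, y i ^ 2 + t⁻¹ * ∑' i, x i ^ 2) := by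
  obtain ⟨hl, hl'⟩ := summable_conv_left hκ hκ0 hj hy fun i => sq_nonneg _
  obtain ⟨hr, hr'⟩ := summable_conv_right hκ hκ0 hj hx fun i => sq_nonneg _
  have hle (q : ι × ι) : κ (j q.1 - j q.2) * x q.2 * y q.1 ≤
      t * (y q.1 ^ 2 * κ (j q.1 - j q.2)) + t⁻¹ * (x q.2 ^ 2 * κ (j q.1 - j q.2)) := by
    have h : x q.2 * y q.1 ≤ t * y q.1 ^ 2 + t⁻¹ * x q.2 ^ 2 := by
      have h1 : t⁻¹ * (t * y q.1 - x q.2) ^ 2 =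
          t * y q.1 ^ 2 + t⁻¹ * x q.2 ^ 2 - 2 * (x q.2 * y q.1) := by
        field_simp; ring
      have h2 : 0 ≤ t⁻¹ * (t * y q.1 - x q.2) ^ 2 := by positivity
      have h3 := mul_nonneg (hx0 q.2) (hy0 q.1)
      linarith
    have := mul_le_mul_of_nonneg_left h (hκ0 (j q.1 - j q.2))
    linarith
  have hS := (hl.mul_left t).add (hr.mul_left t⁻¹)
  have hsum := Summable.of_nonneg_of_le
    (fun q => mul_nonneg (mul_nonneg (hκ0 (j q.1 - j q.2)) (hx0 q.2)) (hy0 q.1)) hle hS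
  refine ⟨hsum, (hsum.tsum_le_tsum hle hS).trans ?_⟩
  rw [(hl.mul_left t).tsum_add (hr.mul_left t⁻¹), tsum_mul_left, tsum_mul_left]
  have h1 := mul_le_mul_of_nonneg_left hl' ht.le
  have h2 := mul_le_mul_of_nonneg_left hr' (inv_nonneg.2 ht.le)
  linarith

end Schur

/-! ### Characters of the torus -/

noncomputable section

/-- The character `exp(i kᵀy)` as an element of `L²(𝕋ⁿ)`. -/
def charL2 {n : ℕ} (k : Fin n → ℤ) : Lp ℂ 2 (torusMeasure n) :=
  ContinuousMap.toLp 2 (torusMeasure n) ℂ (torusChar k)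

end

theorem coeFn_charL2 {n : ℕ} (k : Fin n → ℤ) : charL2 k =ᵐ[torusMeasure n] torusChar k :=
  ContinuousMap.coeFn_toLp _ _

theorem torusChar_mul_conj {n : ℕ} (k l : Fin n → ℤ) (y : Torus n) :
    torusChar k y * conj (torusChar l y) = torusChar (k - l) y := by
  simp only [torusChar, ContinuousMap.coe_mk, map_prod, ← fourier_neg, ← Finset.prod_mul_distrib,
    ← fourier_add, sub_eq_add_neg, Pi.add_apply, Pi.neg_apply]

theorem conj_torusChar {n : ℕ} (k : Fin n → ℤ) (y : Torus n) :
    conj (torusChar k y) = torusChar (-k) y := by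
  simp only [torusChar, ContinuousMap.coe_mk, map_prod, ← fourier_neg, Pi.neg_apply]

theorem integral_torusChar {n : ℕ} (k : Fin n → ℤ) :
    ∫ y, torusChar k y ∂torusMeasure n = if k = 0 then 1 else 0 := by
  split_ifs with h
  · subst h
    have : ∀ y : Torus n, torusChar 0 y = 1 := fun y => by
      simp [torusChar]
    simp [this]
  · obtain ⟨i, hi⟩ := Function.ne_iff.mp h
    simp only [torusChar, ContinuousMap.coe_mk, torusMeasure]
    -- The one-variable factor at `i` vanishes, since `fourier (k i)` is orthogonal to the
    -- constants.
    rw [integral_fintype_prod_eq_prod (f := fun j y => fourier (k j) y)]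
    apply Finset.prod_eq_zero (Finset.mem_univ i)
    have hk : k i ≠ 0 := hi
    simpa [hk.symm, ContinuousMap.inner_toLp] using
      (orthonormal_iff_ite.mp <| orthonormal_fourier (T := 2 * Real.pi)) 0 (k i)

theorem orthonormal_charL2 {n : ℕ} : Orthonormal ℂ (charL2 (n := n)) := by
  classical
  rw [orthonormal_iff_ite]
  intro k l
  rw [charL2, charL2, ContinuousMap.inner_toLp]
  simp_rw [torusChar_mul_conj]
  rw [integral_torusChar]
  simp only [sub_eq_zero, eq_comm]

/-! ### Multiplication by a bounded function on `L²` -/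

section Multiplication

variable {X : Type*} [MeasurableSpace X] {μ : Measure X} {A : X → ℝ} {α₀ α₁ : ℝ}

/-- Multiplication by a bounded measurable function is a bounded operator on `L²`. -/
theorem exists_mulL2 (hA : AEMeasurable A μ) (hα₀ : 0 < α₀)
    (hbound : ∀ y, α₀ ≤ A y ∧ A y ≤ α₁) :
    ∃ T : Lp ℂ 2 μ →L[ℂ] Lp ℂ 2 μ, ∀ f, T f =ᵐ[μ] fun y => (A y : ℂ) * f y := by
  have hAc : AEStronglyMeasurable (fun y => (A y : ℂ)) μ :=
    (Complex.measurable_ofReal.comp_aemeasurable hA).aestronglyMeasurable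
  have hle (f : Lp ℂ 2 μ) (y : X) : ‖(A y : ℂ) * f y‖ ≤ α₁ * ‖f y‖ := by
    rw [norm_mul, Complex.norm_real, Real.norm_of_nonneg (hα₀.le.trans (hbound y).1)]
    gcongr
    exact (hbound y).2
  have hmem (f : Lp ℂ 2 μ) : MemLp (fun y => (A y : ℂ) * f y) 2 μ :=
    (Lp.memLp f).of_le_mul (hAc.mul (Lp.aestronglyMeasurable f)) (.of_forall (hle f))
  let T : Lp ℂ 2 μ →ₗ[ℂ] Lp ℂ 2 μ :=
    { toFun := fun f => (hmem f).toLp _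
      map_add' := fun f g => by
        rw [← MemLp.toLp_add, MemLp.toLp_eq_toLp_iff]
        filter_upwards [Lp.coeFn_add f g] with y hy
        simp only [hy, Pi.add_apply, mul_add]
      map_smul' := fun c f => by
        rw [RingHom.id_apply, ← MemLp.toLp_const_smul, MemLp.toLp_eq_toLp_iff]
        filter_upwards [Lp.coeFn_smul c f] with y hy
        simp only [hy, Pi.smul_apply, smul_eq_mul]
        ring }
  refine ⟨T.mkContinuous α₁ fun f => ?_, fun f => (hmem f).coeFn_toLp⟩
  refine Lp.norm_le_mul_norm_of_ae_le_mul ?_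
  filter_upwards [(hmem f).coeFn_toLp] with y hy
  change ‖(hmem f).toLp _ y‖ ≤ _
  rw [hy]
  exact hle f y

variable {T : Lp ℂ 2 μ →L[ℂ] Lp ℂ 2 μ} (hT : ∀ f, T f =ᵐ[μ] fun y => (A y : ℂ) * f y)
include hT

theorem inner_mulL2 (f g : Lp ℂ 2 μ) :
    inner ℂ g (T f) = ∫ y, (A y : ℂ) * f y * conj (g y) ∂μ := by
  rw [L2.inner_def]
  refine integral_congr_ae ?_
  filter_upwards [hT f] with y hy
  rw [hy, RCLike.inner_apply]

theorem le_re_inner_mulL2 (hbound : ∀ y, α₀ ≤ A y ∧ A y ≤ α₁) (f : Lp ℂ 2 μ) :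
    α₀ * ‖f‖ ^ 2 ≤ (inner ℂ f (T f)).re := by
  have h1 : ‖f‖ ^ 2 = (inner ℂ f f : ℂ).re := by
    rw [inner_self_eq_norm_sq_to_K]; norm_cast
  rw [h1, L2.inner_def, L2.inner_def]
  have i1 := L2.integrable_inner (𝕜 := ℂ) f f
  have i2 := L2.integrable_inner (𝕜 := ℂ) f (T f)
  have e1 : (∫ y, inner ℂ (f y) (f y) ∂μ).re = ∫ y, (inner ℂ (f y) (f y)).re ∂μ :=
    (integral_re i1).symm
  have e2 : (∫ y, inner ℂ (f y) (T f y) ∂μ).re = ∫ y, (inner ℂ (f y) (T f y)).re ∂μ :=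
    (integral_re i2).symm
  rw [e1, e2, ← integral_const_mul]
  refine integral_mono_ae (i1.re.const_mul _) i2.re ?_
  filter_upwards [hT f] with y hy
  have h2 : (inner ℂ (f y) (T f y) : ℂ) = ((A y * ‖f y‖ ^ 2 : ℝ) : ℂ) := by
    rw [hy, RCLike.inner_apply, mul_assoc, Complex.mul_conj, Complex.normSq_eq_norm_sq]
    push_cast; rfl
  have h3 : (inner ℂ (f y) (f y) : ℂ) = ((‖f y‖ ^ 2 : ℝ) : ℂ) := by
    rw [RCLike.inner_apply, Complex.mul_conj, Complex.normSq_eq_norm_sq]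
  change α₀ * (inner ℂ (f y) (f y)).re ≤ (inner ℂ (f y) (T f y)).re
  rw [h2, h3, Complex.ofReal_re, Complex.ofReal_re]
  gcongr
  exact (hbound y).1

end Multiplication

theorem inner_mulL2_charL2 {n : ℕ} {A : Torus n → ℝ}
    {T : Lp ℂ 2 (torusMeasure n) →L[ℂ] Lp ℂ 2 (torusMeasure n)}
    (hT : ∀ f, T f =ᵐ[torusMeasure n] fun y => (A y : ℂ) * f y) (k l : Fin n → ℤ) :
    inner ℂ (charL2 k) (T (charL2 l)) = torusFourierCoeff A (k - l) := by
  rw [inner_mulL2 hT, torusFourierCoeff]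
  refine integral_congr_ae ?_
  filter_upwards [coeFn_charL2 k, coeFn_charL2 l] with y hk hl
  rw [hk, hl, mul_assoc, torusChar_mul_conj, conj_torusChar, neg_sub]

/-! ### Diagonal operators on `L²(𝕋ⁿ)ᵈ` -/

section Diagonal

variable {E : Type*} [NormedAddCommGroup E] [InnerProductSpace ℂ E] {d : ℕ}

/-- An operator on `E` acts componentwise on `Eᵈ`. -/
theorem exists_diagonal (T : E →L[ℂ] E) :
    ∃ S : PiLp 2 (fun _ : Fin d => E) →L[ℂ] PiLp 2 (fun _ : Fin d => E),
      ∀ x j, S x j = T (x j) := by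
  let e := PiLp.continuousLinearEquiv 2 ℂ (fun _ : Fin d => E)
  exact ⟨(e.symm : (Fin d → E) →L[ℂ] PiLp 2 (fun _ : Fin d => E)) ∘L
    (ContinuousLinearMap.pi fun j => T ∘L ContinuousLinearMap.proj j) ∘L
    (e : PiLp 2 (fun _ : Fin d => E) →L[ℂ] (Fin d → E)), fun x j => rfl⟩

theorem le_re_inner_diagonal {T : E →L[ℂ] E} {α : ℝ}
    (hT : ∀ f, α * ‖f‖ ^ 2 ≤ (inner ℂ f (T f)).re)
    {S : PiLp 2 (fun _ : Fin d => E) →L[ℂ] PiLp 2 (fun _ : Fin d => E)}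
    (hS : ∀ x j, S x j = T (x j)) (x : PiLp 2 (fun _ : Fin d => E)) :
    α * ‖x‖ ^ 2 ≤ (inner ℂ x (S x)).re := by
  rw [PiLp.norm_sq_eq_of_L2, PiLp.inner_apply, Complex.re_sum, Finset.mul_sum]
  exact Finset.sum_le_sum fun j _ => by rw [hS]; exact hT (x j)

end Diagonal

/-! ### Square summable sequences -/

section SquareSummable

variable {ι : Type*}

theorem summable_norm_sq_lp (w : lp (fun _ : ι => ℂ) 2) : Summable fun i => ‖w i‖ ^ 2 := by
  have := (lp.memℓp w).summable (by norm_num)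
  simpa using this

theorem norm_sq_lp_eq_tsum (w : lp (fun _ : ι => ℂ) 2) : ‖w‖ ^ 2 = ∑' i, ‖w i‖ ^ 2 := by
  have := lp.norm_rpow_eq_tsum (p := 2) (by norm_num) w
  simpa using this

theorem exists_lp_of_summable {c : ι → ℂ} (h : Summable fun i => ‖c i‖ ^ 2) :
    ∃ w : lp (fun _ : ι => ℂ) 2, ∀ i, w i = c i := by
  have hc : Memℓp (E := fun _ : ι => ℂ) c 2 := by
    refine memℓp_gen ?_
    simpa using h
  exact ⟨⟨c, hc⟩, fun i => rfl⟩

theorem exists_lp_mul {m : ι → ℝ} {M : ℝ} (hm : ∀ i, |m i| ≤ M) (w : lp (fun _ : ι => ℂ) 2) :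
    ∃ u : lp (fun _ : ι => ℂ) 2, ∀ i, u i = m i * w i := by
  refine exists_lp_of_summable (.of_nonneg_of_le (fun i => by positivity) (fun i => ?_)
    ((summable_norm_sq_lp w).mul_left (M ^ 2)))
  rw [norm_mul, mul_pow, Complex.norm_real, Real.norm_eq_abs]
  gcongr
  exact hm i

theorem inner_single_one [DecidableEq ι] (w : lp (fun _ : ι => ℂ) 2) (k : ι) :
    inner ℂ (lp.single (E := fun _ : ι => ℂ) 2 k 1) w = w k :=
  (lp.inner_single_left k 1 w).trans (by simp)

theorem hasSum_smul_single [DecidableEq ι] (w : lp (fun _ : ι => ℂ) 2) :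
    HasSum (fun l => w l • lp.single (E := fun _ : ι => ℂ) 2 l (1 : ℂ)) w := by
  have h1 : HasSum (fun l => lp.single (E := fun _ : ι => ℂ) 2 l (w l)) w :=
    lp.hasSum_single (by norm_num) w
  refine h1.congr_fun fun l => ?_
  rw [← lp.single_smul]
  simp

variable (B : lp (fun _ : ι => ℂ) 2 →L[ℂ] lp (fun _ : ι => ℂ) 2)

theorem hasSum_matrix_apply [DecidableEq ι] (w : lp (fun _ : ι => ℂ) 2) (k : ι) :
    HasSum (fun l => w l * B (lp.single (E := fun _ : ι => ℂ) 2 l 1) k) (B w k) := by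
  have h2 := (innerSL ℂ (lp.single (E := fun _ : ι => ℂ) 2 k (1 : ℂ))).hasSum
    (B.hasSum (hasSum_smul_single w))
  rw [innerSL_apply_apply, inner_single_one] at h2
  refine h2.congr_fun fun l => ?_
  rw [map_smul, map_smul, innerSL_apply_apply,
    inner_single_one, smul_eq_mul]

variable {a : ι → ι → ℂ}

/-- The energy estimate behind the regularity theorem: a coercive operator controls `m w`
by the weighted right-hand side and the commutator with the multiplier `m`. -/
theorem energy_estimate
    (ha : ∀ (w : lp (fun _ : ι => ℂ) 2) (k : ι), HasSum (fun l => w l * a k l) (B w k)) {α : ℝ} (hB : ∀ w, α * ‖w‖ ^ 2 ≤ (inner ℂ w (B w)).re)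
    {m : ι → ℝ} {M : ℝ} (hm0 : ∀ i, 0 ≤ m i) (hm : ∀ i, m i ≤ M) (w : lp (fun _ : ι => ℂ) 2)
    {D : ι × ι → ℝ} (hD : Summable D)
    (hle : ∀ q : ι × ι, |m q.1 - m q.2| * ‖a q.1 q.2‖ * ‖w q.2‖ *
      (m q.1 * ‖w q.1‖) ≤ D q) :
    α * ∑' i, (m i * ‖w i‖) ^ 2 ≤ ∑' i, (m i * ‖w i‖) * (m i * ‖B w i‖) + ∑' q, D q := by
  have hmabs : ∀ i, |m i| ≤ M := fun i => by rw [abs_of_nonneg (hm0 i)]; exact hm i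
  obtain ⟨u, hu⟩ := exists_lp_mul hmabs w
  obtain ⟨z, hz⟩ := exists_lp_mul hmabs (B w)
  have hunorm : ‖u‖ ^ 2 = ∑' i, (m i * ‖w i‖) ^ 2 := by
    rw [norm_sq_lp_eq_tsum]
    congr 1; ext i
    rw [hu, norm_mul, Complex.norm_real, Real.norm_of_nonneg (hm0 i)]
  -- The terms of `⟨u, [m, B] w⟩`, where `u = m w` and `z = m (B w)`; row `k` sums to `conj (u k) *
  -- (z k - B u k)`.
  let x : ι × ι → ℂ := fun q =>
    conj (u q.1) * (((m q.1 - m q.2 : ℝ) : ℂ) * a q.1 q.2 * w q.2)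
  have hxD : ∀ q, ‖x q‖ ≤ D q := fun q => by
    refine le_trans (le_of_eq ?_) (hle q)
    simp only [x]
    rw [norm_mul, norm_mul, norm_mul, RCLike.norm_conj, hu, norm_mul, Complex.norm_real,
      Complex.norm_real, Real.norm_of_nonneg (hm0 _), Real.norm_eq_abs]
    ring
  have hx : Summable x := .of_norm_bounded hD hxD
  have hrow : ∀ k, HasSum (fun l => x (k, l)) (conj (u k) * (z k - B u k)) := fun k => by
    have h1 := (((ha w k).mul_left (m k : ℂ)).sub (ha u k)).mul_left (conj (u k))
    rw [← hz] at h1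
    refine h1.congr_fun fun l => ?_
    simp only [x, hu l]
    push_cast
    ring
  have hsum : HasSum (fun k => conj (u k) * (z k - B u k)) (∑' q, x q) :=
    hx.hasSum.prod_fiberwise hrow
  have hin : inner ℂ u (z - B u) = ∑' q, x q := by
    refine HasSum.unique ?_ hsum
    refine (lp.hasSum_inner u (z - B u)).congr_fun fun k => ?_
    rw [RCLike.inner_apply, mul_comm]
    rfl
  have h1 : (inner ℂ u z).re - (inner ℂ u (B u)).re = (∑' q, x q).re := by
    rw [← hin, inner_sub_right, Complex.sub_re]
  have h2 : -(∑' q, D q) ≤ (∑' q, x q).re :=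
    (abs_le.1 ((Complex.abs_re_le_norm _).trans (tsum_of_norm_bounded hD.hasSum hxD))).1
  have hprod : ∀ i, ‖u i‖ * ‖z i‖ = (m i * ‖w i‖) * (m i * ‖B w i‖) := fun i => by
    rw [hu, hz, norm_mul, norm_mul, Complex.norm_real, Real.norm_of_nonneg (hm0 i)]
  have h3 : (inner ℂ u z).re ≤ ∑' i, (m i * ‖w i‖) * (m i * ‖B w i‖) := by
    have hs : Summable fun i => ‖u i‖ * ‖z i‖ :=
      lp.summable_mul (by rw [Real.holderConjugate_iff]; norm_num) u z
    simp_rw [← hprod]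
    refine (Complex.re_le_norm _).trans ?_
    rw [lp.inner_eq_tsum]
    exact tsum_of_norm_bounded hs.hasSum fun i => norm_inner_le_norm _ _
  have h4 := hB u
  rw [hunorm] at h4
  linarith

theorem min_rpow_le {p M r : ℝ} (hp : 0 ≤ p) (hM : 0 ≤ M) (hr : 0 ≤ r) :
    min p M ^ r ≤ p ^ r ∧ min p M ^ r ≤ M ^ r :=
  ⟨Real.rpow_le_rpow (le_min hp hM) (min_le_left _ _) hr,
    Real.rpow_le_rpow (le_min hp hM) (min_le_right _ _) hr⟩

/-- Elliptic regularity on the Fourier side: if the commutators of `B` with the truncated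
weights `min(p, M)^(s+1)` are of order `s` uniformly in `M`, then a solution of `B w = f`
inherits the weighted summability of `f`. -/
theorem summable_weighted_of_apply
    (ha : ∀ (w : lp (fun _ : ι => ℂ) 2) (k : ι), HasSum (fun l => w l * a k l) (B w k))
    {G : Type*} [AddCommGroup G] {κ : G → ℝ} {j : ι → G}
    (hκ : Summable κ) (hκ0 : ∀ g, 0 ≤ κ g) (hj : Function.Injective j)
    {α : ℝ} (hα : 0 < α) (hB : ∀ w, α * ‖w‖ ^ 2 ≤ (inner ℂ w (B w)).re)
    {p : ι → ℝ} (hp : ∀ i, 0 ≤ p i) {s : ℝ} (hs : 0 ≤ s)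
    (hcomm : ∀ M : ℝ, 0 ≤ M → ∀ k l : ι,
      |min (p k) M ^ (s + 1) - min (p l) M ^ (s + 1)| * ‖a k l‖ ≤
        κ (j k - j l) * (min (p l) M ^ s + 1))
    (w : lp (fun _ : ι => ℂ) 2)
    (hf : Summable fun i => (p i ^ (s + 1) * ‖B w i‖) ^ 2) :
    Summable fun i => (p i ^ (s + 1) * ‖w i‖) ^ 2 := by
  have hs1 : 0 ≤ s + 1 := by linarith
  set K := ∑' g, κ g with hK
  have hK0 : 0 ≤ K := tsum_nonneg hκ0
  -- The choices of `t` and `δ` make two commutator contributions at most `α / 4 * Y` each. The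
  -- right-hand side costs a third, so a quarter of the coercivity survives. Using `K + 1` covers `K
  -- = 0`.
  set t := α / (4 * (K + 1)) with ht
  have htpos : 0 < t := by positivity
  have hKt : K * t ≤ α / 4 := by
    rw [ht, mul_div_assoc', div_le_div_iff₀ (by positivity) (by norm_num)]
    nlinarith
  set δ := α * t / (4 * (K + 1)) with hδdef
  have hδ : 0 < δ := by positivity
  have hKδ : K * t⁻¹ * δ ≤ α / 4 := by
    have : K * t⁻¹ * δ = K * α / (4 * (K + 1)) := by rw [hδdef]; field_simp
    rw [this, div_le_div_iff₀ (by positivity) (by norm_num)]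
    nlinarith
  obtain ⟨C, hC0, hC⟩ := exists_sq_rpow_add_one_le hs hδ
  have hw := summable_norm_sq_lp w
  set Fs := ∑' i, (p i ^ (s + 1) * ‖B w i‖) ^ 2 with hFs
  set W := ∑' i, ‖w i‖ ^ 2 with hW
  have hbound : ∀ M : ℝ, 0 ≤ M →
      Summable (fun i => (min (p i) M ^ (s + 1) * ‖w i‖) ^ 2) ∧
      ∑' i, (min (p i) M ^ (s + 1) * ‖w i‖) ^ 2 ≤ 4 / α * (α⁻¹ * Fs + K * t⁻¹ * (C * W)) := by
    intro M hM
    have hφ0 : ∀ i, 0 ≤ min (p i) M := fun i => le_min (hp i) hM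
    set m : ι → ℝ := fun i => min (p i) M ^ (s + 1) with hmdef
    have hm0 : ∀ i, 0 ≤ m i := fun i => Real.rpow_nonneg (hφ0 i) _
    have hmp : ∀ i, m i ≤ p i ^ (s + 1) := fun i => (min_rpow_le (hp i) hM hs1).1
    have hmM : ∀ i, m i ≤ M ^ (s + 1) := fun i => (min_rpow_le (hp i) hM hs1).2
    -- Truncation makes this sum finite a priori, which is what permits absorbing it.
    have hY : Summable fun i => (m i * ‖w i‖) ^ 2 := by
      refine .of_nonneg_of_le (fun i => sq_nonneg _) (fun i => ?_)
        (hw.mul_left ((M ^ (s + 1)) ^ 2))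
      rw [mul_pow]
      have := hm0 i
      gcongr
      exact hmM i
    set Y := ∑' i, (m i * ‖w i‖) ^ 2 with hYdef
    let X : ι → ℝ := fun i => (min (p i) M ^ s + 1) * ‖w i‖
    have hX0 : ∀ i, 0 ≤ X i := fun i => by
      have := Real.rpow_nonneg (hφ0 i) s
      positivity
    have hXle : ∀ i, X i ^ 2 ≤ δ * (m i * ‖w i‖) ^ 2 + C * ‖w i‖ ^ 2 := fun i => by
      have := mul_le_mul_of_nonneg_right (hC _ (hφ0 i)) (sq_nonneg ‖w i‖)
      simp only [X, mul_pow]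
      linarith
    have hXs : Summable fun i => X i ^ 2 :=
      .of_nonneg_of_le (fun i => sq_nonneg _) hXle ((hY.mul_left δ).add (hw.mul_left C))
    have hXt : ∑' i, X i ^ 2 ≤ δ * Y + C * W := by
      refine (hXs.tsum_le_tsum hXle ((hY.mul_left δ).add (hw.mul_left C))).trans (le_of_eq ?_)
      rw [(hY.mul_left δ).tsum_add (hw.mul_left C), tsum_mul_left, tsum_mul_left]
    have hY0 : ∀ i, 0 ≤ m i * ‖w i‖ := fun i => mul_nonneg (hm0 i) (norm_nonneg _)
    obtain ⟨hD, hDle⟩ := summable_conv_mul hκ hκ0 hj hXs hY hX0 hY0 htpos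
    have hE := energy_estimate B ha hB hm0 hmM w hD fun q => by
      have h1 := hcomm M hM q.1 q.2
      have h2 := mul_le_mul_of_nonneg_right
        (mul_le_mul_of_nonneg_right h1 (norm_nonneg (w q.2))) (hY0 q.1)
      refine h2.trans (le_of_eq ?_)
      simp only [X]
      ring
    have hfle : ∀ i, (m i * ‖w i‖) * (m i * ‖B w i‖) ≤
        α / 4 * (m i * ‖w i‖) ^ 2 + α⁻¹ * (p i ^ (s + 1) * ‖B w i‖) ^ 2 := fun i => by
      have h1 : m i * ‖B w i‖ ≤ p i ^ (s + 1) * ‖B w i‖ := by gcongr; exact hmp i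
      have h2 := mul_le_mul_of_nonneg_left h1 (hY0 i)
      set a := m i * ‖w i‖
      set b := p i ^ (s + 1) * ‖B w i‖
      have h3 : α / 4 * a ^ 2 + α⁻¹ * b ^ 2 - a * b = α⁻¹ * (α / 2 * a - b) ^ 2 := by
        field_simp; ring
      have h4 : 0 ≤ α⁻¹ * (α / 2 * a - b) ^ 2 := by positivity
      linarith
    have hS := (hY.mul_left (α / 4)).add (hf.mul_left α⁻¹)
    have hft : ∑' i, (m i * ‖w i‖) * (m i * ‖B w i‖) ≤ α / 4 * Y + α⁻¹ * Fs := by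
      have hsum := Summable.of_nonneg_of_le
        (fun i => mul_nonneg (hY0 i) (mul_nonneg (hm0 i) (norm_nonneg (B w i)))) hfle hS
      refine (hsum.tsum_le_tsum hfle hS).trans (le_of_eq ?_)
      rw [(hY.mul_left _).tsum_add (hf.mul_left _), tsum_mul_left, tsum_mul_left]
    refine ⟨hY, ?_⟩
    have hYnn : 0 ≤ Y := tsum_nonneg fun i => sq_nonneg _
    have e1 : K * (t * Y + t⁻¹ * ∑' i, X i ^ 2) ≤
        α / 4 * Y + (α / 4 * Y + K * t⁻¹ * (C * W)) := by
      have a1 := mul_le_mul_of_nonneg_right hKt hYnn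
      have a2 := mul_le_mul_of_nonneg_right hKδ hYnn
      have a3 := mul_le_mul_of_nonneg_left hXt (by positivity : 0 ≤ K * t⁻¹)
      linarith
    have e2 : α / 4 * Y ≤ α⁻¹ * Fs + K * t⁻¹ * (C * W) := by linarith
    have e3 := mul_le_mul_of_nonneg_left e2 (by positivity : 0 ≤ 4 / α)
    have e4 : 4 / α * (α / 4 * Y) = Y := by field_simp
    linarith
  refine summable_of_sum_le (fun i => sq_nonneg _)
    (c := 4 / α * (α⁻¹ * Fs + K * t⁻¹ * (C * W))) fun u => ?_
  -- This `M` dominates every `p i` on `u`, so the truncation is inactive there.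
  have hM0 : 0 ≤ ∑ i ∈ u, p i := Finset.sum_nonneg fun i _ => hp i
  obtain ⟨h1, h2⟩ := hbound _ hM0
  refine le_trans (le_of_eq ?_) ((h1.sum_le_tsum u fun i _ => sq_nonneg _).trans h2)
  refine Finset.sum_congr rfl fun i hi => ?_
  rw [min_eq_left (Finset.single_le_sum (fun i _ => hp i) hi)]

end SquareSummable

/-! ### Coercive operators -/

/-- The Lax–Milgram theorem in operator form. -/
theorem bijective_of_coercive {H : Type*} [NormedAddCommGroup H] [InnerProductSpace ℂ H]
    [CompleteSpace H] (B : H →L[ℂ] H) {α : ℝ} (hα : 0 < α)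
    (hB : ∀ w, α * ‖w‖ ^ 2 ≤ (inner ℂ w (B w)).re) : Function.Bijective B := by
  rw [← ContinuousLinearMap.isUnit_iff_bijective]
  refine ContinuousLinearMap.isUnit_of_forall_le_norm_inner_map B (c := ⟨α, hα.le⟩) hα fun w => ?_
  rw [norm_inner_symm, mul_comm]
  exact (hB w).trans (Complex.re_le_norm _)

theorem rpow_two_mul {x : ℝ} (hx : 0 ≤ x) (r : ℝ) : x ^ (2 * r) = (x ^ r) ^ 2 := by
  rw [mul_comm, Real.rpow_mul hx, Real.rpow_two]

/-! ### Projected frequencies -/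

section ProjFreq

variable {d n : ℕ} {P : Matrix (Fin d) (Fin n) ℝ}

theorem projFreq_sub (k l : Fin n → ℤ) : projFreq P (k - l) = projFreq P k - projFreq P l := by
  ext i
  simp [projFreq, Matrix.mulVec, dotProduct, mul_sub]

/-- A zero of `P k` would be a rational relation between the columns. -/
theorem IsProjectionMatrix.projFreq_ne_zero (hP : IsProjectionMatrix P) {k : Fin n → ℤ}
    (hk : k ≠ 0) : projFreq P k ≠ 0 := by
  intro h
  apply hk
  have h1 : ∑ j, (k j : ℚ) • P.col j = 0 := by
    ext i
    have := congrArg (fun z : EuclideanSpace ℝ (Fin d) => z i) h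
    simp only [projFreq, Matrix.mulVec, dotProduct, PiLp.zero_apply] at this
    simp only [Finset.sum_apply, Pi.smul_apply, Matrix.col_apply, Pi.zero_apply, Rat.smul_def,
      Rat.cast_intCast]
    rw [← this]
    exact Finset.sum_congr rfl fun j _ => mul_comm _ _
  have h2 := Fintype.linearIndependent_iff.1 hP (fun j => (k j : ℚ)) h1
  ext j
  exact_mod_cast h2 j

theorem IsProjectionMatrix.norm_projFreq_pos (hP : IsProjectionMatrix P)
    (k : {k : Fin n → ℤ // k ≠ 0}) : 0 < ‖projFreq P k‖ :=
  norm_pos_iff.2 (hP.projFreq_ne_zero k.2)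

theorem exists_norm_projFreq_le (P : Matrix (Fin d) (Fin n) ℝ) :
    ∃ c : ℝ, 1 ≤ c ∧ ∀ k : Fin n → ℤ, ‖projFreq P k‖ ≤ c * ‖freq k‖ := by
  let L := (Matrix.toLin (EuclideanSpace.basisFun (Fin n) ℝ).toBasis
    (EuclideanSpace.basisFun (Fin d) ℝ).toBasis P).toContinuousLinearMap
  have hL : ∀ k : Fin n → ℤ, L (freq k) = projFreq P k := fun k => by
    simp only [L, LinearMap.coe_toContinuousLinearMap']
    rw [Matrix.toLin_apply]
    ext i
    simp [freq, projFreq, Pi.single_apply, Matrix.mulVec, dotProduct]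
  refine ⟨max 1 ‖L‖, le_max_left _ _, fun k => ?_⟩
  rw [← hL]
  refine (L.le_opNorm _).trans ?_
  gcongr
  exact le_max_right _ _

end ProjFreq

/-! ### The commutator kernel -/

/-- Truncation at `M` is 1-Lipschitz, so the difference of the weights is controlled by `k - l`
uniformly in `M`. It costs `s + 1` powers of `1 + |k - l|`, and the remaining decay `N - (s + 1)`
still exceeds `n`. -/
theorem exists_commutator_kernel {d n : ℕ} (P : Matrix (Fin d) (Fin n) ℝ) {A : Torus n → ℝ}
    {s N : ℝ} (hs : 0 ≤ s) (hN : (n : ℝ) + s + 1 < N) (hdecay : HasFourierDecay A N) :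
    ∃ κ : (Fin n → ℤ) → ℝ, Summable κ ∧ (∀ h, 0 ≤ κ h) ∧
      ∀ M : ℝ, 0 ≤ M → ∀ k l : Fin n → ℤ,
        |min ‖projFreq P k‖ M ^ (s + 1) - min ‖projFreq P l‖ M ^ (s + 1)| *
          ‖torusFourierCoeff A (k - l)‖ ≤ κ (k - l) * (min ‖projFreq P l‖ M ^ s + 1) := by
  obtain ⟨C, hC, hdec⟩ := hdecay
  obtain ⟨c, hc, hPc⟩ := exists_norm_projFreq_le P
  refine ⟨fun h => (s + 1) * 2 ^ s * c ^ (s + 1) * C * (1 + ‖freq h‖) ^ (-(N - (s + 1))),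
    (summable_one_add_norm_freq_rpow (by linarith)).mul_left _, fun h => by positivity,
    fun M hM k l => ?_⟩
  set H := 1 + ‖freq (k - l)‖ with hH
  have hH1 : 1 ≤ H := by have := norm_nonneg (freq (k - l)); linarith
  set x := min ‖projFreq P k‖ M
  set y := min ‖projFreq P l‖ M
  have hx : 0 ≤ x := le_min (norm_nonneg _) hM
  have hy : 0 ≤ y := le_min (norm_nonneg _) hM
  have hcH : 1 ≤ c * H := one_le_mul_of_one_le_of_one_le hc hH1
  have hxy : |x - y| ≤ c * H := by
    calc |x - y| ≤ max |‖projFreq P k‖ - ‖projFreq P l‖| |M - M| := abs_min_sub_min_le_max _ _ _ _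
      _ = |‖projFreq P k‖ - ‖projFreq P l‖| := by simp
      _ ≤ ‖projFreq P k - projFreq P l‖ := abs_norm_sub_norm_le _ _
      _ = ‖projFreq P (k - l)‖ := by rw [projFreq_sub]
      _ ≤ c * ‖freq (k - l)‖ := hPc _
      _ ≤ c * H := by gcongr; linarith
  have h1 : |x - y| * (y ^ s + |x - y| ^ s) ≤ c ^ (s + 1) * H ^ (s + 1) * (y ^ s + 1) := by
    have hp : 1 ≤ (c * H) ^ s := Real.one_le_rpow hcH hs
    have hys : 0 ≤ y ^ s := Real.rpow_nonneg hy s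
    calc |x - y| * (y ^ s + |x - y| ^ s) ≤ c * H * (y ^ s + (c * H) ^ s) := by gcongr
      _ ≤ c * H * ((c * H) ^ s * (y ^ s + 1)) := by gcongr; nlinarith
      _ = (c * H) ^ (s + 1) * (y ^ s + 1) := by
        rw [Real.rpow_add_one (by positivity)]; ring
      _ = _ := by rw [Real.mul_rpow (by positivity) (by positivity)]
  calc _ ≤ ((s + 1) * 2 ^ s * (c ^ (s + 1) * H ^ (s + 1) * (y ^ s + 1))) * (C * H ^ (-N)) := by
        gcongr
        · exact (abs_rpow_sub_rpow_le hx hy hs).trans (by gcongr)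
        · exact hdec _
    _ = (s + 1) * 2 ^ s * c ^ (s + 1) * C * (H ^ (s + 1) * H ^ (-N)) * (y ^ s + 1) := by ring
    _ = _ := by
      rw [← Real.rpow_add (by positivity), ← sub_eq_add_neg, neg_sub]

/-! ### The elliptic operator on the Fourier side -/

noncomputable section

section Frame

variable {E : Type*} [NormedAddCommGroup E] [InnerProductSpace ℂ E] {d : ℕ} {ι : Type*}

/-- The vector `i e ⊗ χ` of `Eᵈ`. -/
def gradVec (e : EuclideanSpace ℝ (Fin d)) (χ : E) : PiLp 2 (fun _ : Fin d => E) :=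
  WithLp.toLp 2 fun j => (Complex.I * (e j : ℂ)) • χ

theorem inner_gradVec (T : E →L[ℂ] E)
    {S : PiLp 2 (fun _ : Fin d => E) →L[ℂ] PiLp 2 (fun _ : Fin d => E)}
    (hS : ∀ x j, S x j = T (x j)) (e e' : EuclideanSpace ℝ (Fin d)) (χ χ' : E) :
    inner ℂ (gradVec e χ) (S (gradVec e' χ')) =
      ((inner ℝ e e' : ℝ) : ℂ) * inner ℂ χ (T χ') := by
  rw [PiLp.inner_apply, PiLp.inner_apply, Complex.ofReal_sum, Finset.sum_mul]
  refine Finset.sum_congr rfl fun j _ => ?_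
  rw [hS]
  simp only [gradVec, map_smul, inner_smul_left, inner_smul_right, map_mul, Complex.conj_I,
    Complex.conj_ofReal, RCLike.inner_apply, conj_trivial, Complex.ofReal_mul]
  linear_combination (-(e j : ℂ) * (e' j : ℂ) * inner ℂ χ (T χ')) * Complex.I_sq

theorem orthonormal_gradVec {e : ι → EuclideanSpace ℝ (Fin d)} (he : ∀ i, ‖e i‖ = 1) {χ : ι → E}
    (hχ : Orthonormal ℂ χ) : Orthonormal ℂ fun i => gradVec (e i) (χ i) := by
  classical
  rw [orthonormal_iff_ite] at hχ ⊢
  intro i k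
  have := inner_gradVec (ContinuousLinearMap.id ℂ E)
    (S := ContinuousLinearMap.id ℂ (PiLp 2 fun _ : Fin d => E)) (fun _ _ => rfl)
    (e i) (e k) (χ i) (χ k)
  rw [ContinuousLinearMap.id_apply, ContinuousLinearMap.id_apply, hχ] at this
  rw [this]
  split_ifs with h
  · subst h
    simp [he]
  · simp

theorem hasSum_gradVec_apply {e : ι → EuclideanSpace ℝ (Fin d)} {χ : ι → E} {c : ι → ℂ}
    {x : PiLp 2 (fun _ : Fin d => E)} (h : HasSum (fun i => c i • gradVec (e i) (χ i)) x)
    (j : Fin d) : HasSum (fun i => (c i * (Complex.I * (e i j : ℂ))) • χ i) (x j) := by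
  refine ((PiLp.proj 2 (𝕜 := ℂ) (fun _ : Fin d => E) j).hasSum h).congr_fun fun i => ?_
  rw [mul_smul]
  rfl

end Frame

variable {d n : ℕ}

/-- `w` is the sequence `|P k| Ûₖ`, `k ≠ 0`, of a zero-mean series `U`. -/
def IsEnergySeq (P : Matrix (Fin d) (Fin n) ℝ) (U : FourierSeries n)
    (w : lp (fun _ : {k : Fin n → ℤ // k ≠ 0} => ℂ) 2) : Prop :=
  U 0 = 0 ∧ ∀ k : {k : Fin n → ℤ // k ≠ 0}, w k = (‖projFreq P k‖ : ℂ) * U k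

end

section EnergySeq

variable {d n : ℕ} {P : Matrix (Fin d) (Fin n) ℝ}

theorem exists_isEnergySeq {U : FourierSeries n} (hU : U ∈ HbarP0 P 1) :
    ∃ w, IsEnergySeq P U w := by
  obtain ⟨w, hw⟩ := exists_lp_of_summable
    (c := fun k : {k : Fin n → ℤ // k ≠ 0} => (‖projFreq P k‖ : ℂ) * U k) (by
      refine hU.2.congr fun k => ?_
      rw [norm_mul, Complex.norm_real, norm_norm, mul_pow, mul_one, Real.rpow_two])
  exact ⟨w, hU.1, hw⟩

theorem exists_mem_of_lp (hP : IsProjectionMatrix P)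
    (w : lp (fun _ : {k : Fin n → ℤ // k ≠ 0} => ℂ) 2) :
    ∃ U ∈ HbarP0 P 1, IsEnergySeq P U w := by
  classical
  let U : FourierSeries n := fun k => if h : k ≠ 0 then (‖projFreq P k‖ : ℂ)⁻¹ * w ⟨k, h⟩ else 0
  have hw : ∀ k : {k : Fin n → ℤ // k ≠ 0}, w k = (‖projFreq P k‖ : ℂ) * U k := fun k => by
    have hp : (‖projFreq P k‖ : ℂ) ≠ 0 := by exact_mod_cast (hP.norm_projFreq_pos k).ne'
    simp only [U, dif_pos k.2]
    rw [mul_inv_cancel_left₀ hp]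
  have hU0 : U 0 = 0 := by simp [U]
  refine ⟨U, ⟨hU0, (summable_norm_sq_lp w).congr fun k => ?_⟩, hU0, hw⟩
  rw [hw, norm_mul, Complex.norm_real, norm_norm, mul_pow, mul_one, Real.rpow_two]

theorem IsEnergySeq.unique (hP : IsProjectionMatrix P) {U V : FourierSeries n}
    {w : lp (fun _ : {k : Fin n → ℤ // k ≠ 0} => ℂ) 2} (hU : IsEnergySeq P U w)
    (hV : IsEnergySeq P V w) : U = V := by
  ext k
  by_cases hk : k = 0
  · rw [hk, hU.1, hV.1]
  · have hp : (‖projFreq P k‖ : ℂ) ≠ 0 := by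
      exact_mod_cast (hP.norm_projFreq_pos ⟨k, hk⟩).ne'
    exact mul_left_cancel₀ hp ((hU.2 ⟨k, hk⟩).symm.trans (hV.2 ⟨k, hk⟩))

end EnergySeq

/-- The fields `i (P k / |P k|) exp(i kᵀy)` are orthonormal, so they define an isometry `Φ` carrying
the energy sequence of `U` to `P∇U`. Then `B = Φ* S Φ`, with `S` multiplication by `A`, inherits
coercivity. -/
theorem exists_ellipticOperator {d n : ℕ} {P : Matrix (Fin d) (Fin n) ℝ}
    (hP : IsProjectionMatrix P) {A : Torus n → ℝ} (hA : AEMeasurable A (torusMeasure n))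
    {α₀ α₁ : ℝ} (hα₀ : 0 < α₀) (hbound : ∀ y, α₀ ≤ A y ∧ A y ≤ α₁) :
    ∃ B : lp (fun _ : {k : Fin n → ℤ // k ≠ 0} => ℂ) 2 →L[ℂ]
        lp (fun _ : {k : Fin n → ℤ // k ≠ 0} => ℂ) 2,
      (∀ w, α₀ * ‖w‖ ^ 2 ≤ (inner ℂ w (B w)).re) ∧
      (∀ k l, ‖B (lp.single (E := fun _ : {k : Fin n → ℤ // k ≠ 0} => ℂ) 2 l 1) k‖ ≤
        ‖torusFourierCoeff A (k - l)‖) ∧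
      ∀ U V w u, IsEnergySeq P U w → IsEnergySeq P V u →
        ellipticForm P A U V = inner ℂ u (B w) := by
  obtain ⟨T, hT⟩ := exists_mulL2 hA hα₀ hbound
  obtain ⟨S, hS⟩ := exists_diagonal (d := d) T
  let e : {k : Fin n → ℤ // k ≠ 0} → EuclideanSpace ℝ (Fin d) :=
    fun k => ‖projFreq P k‖⁻¹ • projFreq P k
  have he : ∀ k, ‖e k‖ = 1 := fun k => by
    rw [norm_smul, norm_inv, norm_norm, inv_mul_cancel₀ (hP.norm_projFreq_pos k).ne']
  let v : {k : Fin n → ℤ // k ≠ 0} → PiLp 2 (fun _ : Fin d => Lp ℂ 2 (torusMeasure n)) :=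
    fun k => gradVec (e k) (charL2 k.1)
  have hv : Orthonormal ℂ v :=
    orthonormal_gradVec he (orthonormal_charL2.comp _ Subtype.val_injective)
  let Φ := hv.orthogonalFamily.linearIsometry
  have hΦsum : ∀ w, HasSum (fun k => w k • v k) (Φ w) := fun w =>
    hv.orthogonalFamily.hasSum_linearIsometry w
  have hΦsingle : ∀ k, Φ (lp.single 2 k (1 : ℂ)) = v k := fun k =>
    (hv.orthogonalFamily.linearIsometry_apply_single _).trans (one_smul ℂ _)
  let Φc := Φ.toContinuousLinearMap
  let B := (ContinuousLinearMap.adjoint Φc) ∘L S ∘L Φc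
  have hB : ∀ u w, inner ℂ u (B w) = inner ℂ (Φ u) (S (Φ w)) := fun u w =>
    ContinuousLinearMap.adjoint_inner_right Φc u (S (Φ w))
  refine ⟨B, fun w => ?_, fun k l => ?_, fun U V w u hU hV => ?_⟩
  · rw [hB, ← Φ.norm_map w]
    exact le_re_inner_diagonal (le_re_inner_mulL2 hT hbound) hS (Φ w)
  · rw [← inner_single_one, hB, hΦsingle, hΦsingle, inner_gradVec T hS, inner_mulL2_charL2 hT,
      norm_mul, Complex.norm_real]
    -- Cauchy–Schwarz for the unit vectors `e k` and `e l`.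
    refine mul_le_of_le_one_left (norm_nonneg _) ?_
    simpa [he] using norm_inner_le_norm (𝕜 := ℝ) (e k) (e l)
  · have hgrad : ∀ U w, IsEnergySeq P U w → ∀ j, (projGrad P U j).toL2 = Φ w j := by
      intro U w hU j
      have h1 := hasSum_gradVec_apply (hΦsum w) j
      have hc : ∀ k : {k : Fin n → ℤ // k ≠ 0},
          projGrad P U j k = w k * (Complex.I * (e k j : ℂ)) := fun k => by
        have hp : (‖projFreq P k‖ : ℂ) ≠ 0 := by exact_mod_cast (hP.norm_projFreq_pos k).ne'
        simp only [e, hU.2, projGrad, PiLp.smul_apply, smul_eq_mul]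
        push_cast
        field_simp
      have h2 : HasSum (fun k : {k : Fin n → ℤ // k ≠ 0} =>
          projGrad P U j k • charL2 k.1) (Φ w j) :=
        h1.congr_fun fun k => by rw [hc]
      -- The zero frequency contributes nothing. Convergence here ensures that the `tsum` in `toL2`
      -- is the genuine sum.
      have h3 : HasSum (fun k => projGrad P U j k • charL2 k) (Φ w j) := by
        refine (Function.Injective.hasSum_iff Subtype.val_injective fun k hk => ?_).1 h2
        have hk0 : k = 0 := by
          by_contra h
          exact hk ⟨⟨k, h⟩, rfl⟩
        rw [projGrad, hk0, hU.1, mul_zero, zero_smul]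
      exact h3.tsum_eq
    rw [hB, PiLp.inner_apply, ellipticForm]
    refine Finset.sum_congr rfl fun j _ => ?_
    rw [hS, inner_mulL2 hT, hgrad U w hU, hgrad V u hV]

theorem dualPairing_eq_inner {d n : ℕ} {P : Matrix (Fin d) (Fin n) ℝ}
    (hP : IsProjectionMatrix P) {F V : FourierSeries n}
    {f u : lp (fun _ : {k : Fin n → ℤ // k ≠ 0} => ℂ) 2}
    (hf : ∀ k : {k : Fin n → ℤ // k ≠ 0}, f k = (‖projFreq P k‖ : ℂ)⁻¹ * F k)
    (hV : IsEnergySeq P V u) : dualPairing F V = inner ℂ u f := by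
  rw [dualPairing, lp.inner_eq_tsum]
  refine tsum_congr fun k => ?_
  have hp : (‖projFreq P k‖ : ℂ) ≠ 0 := by exact_mod_cast (hP.norm_projFreq_pos k).ne'
  rw [RCLike.inner_apply, hf, hV.2, map_mul, Complex.conj_ofReal]
  field_simp

theorem corollary3p2 {d n : ℕ} (P : Matrix (Fin d) (Fin n) ℝ) (hP : IsProjectionMatrix P)
    (A : Torus n → ℝ) (hA : AEMeasurable A (torusMeasure n))
    (α₀ α₁ : ℝ) (hα₀ : 0 < α₀) (hbound : ∀ y, α₀ ≤ A y ∧ A y ≤ α₁)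
    (s N : ℝ) (hs : 0 ≤ s) (hN : (n : ℝ) + s + 1 < N) (hdecay : HasFourierDecay A N)
    (F : FourierSeries n) (hF₁ : F ∈ HbarP0 P (-1)) (hFs : F ∈ HbarP0 P s) :
    (∃! U : FourierSeries n, IsVariationalSolution P A F U) ∧
      ∀ U : FourierSeries n, IsVariationalSolution P A F U → U ∈ HbarP0 P (s + 2) := by
  obtain ⟨B, hcoer, hmat, hform⟩ := exists_ellipticOperator hP hA hα₀ hbound
  have hpos := hP.norm_projFreq_pos
  obtain ⟨f, hf⟩ := exists_lp_of_summable
    (c := fun k : {k : Fin n → ℤ // k ≠ 0} => (‖projFreq P k‖ : ℂ)⁻¹ * F k) (by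
      refine hF₁.2.congr fun k => ?_
      rw [norm_mul, norm_inv, Complex.norm_real, norm_norm, mul_pow, mul_neg_one,
        Real.rpow_neg (norm_nonneg _), Real.rpow_two, inv_pow])
  have hsol : ∀ {U w}, IsEnergySeq P U w → IsVariationalSolution P A F U → B w = f := by
    intro U w hUw hU
    refine ext_inner_left ℂ fun u => ?_
    obtain ⟨V, hVmem, hV⟩ := exists_mem_of_lp hP u
    rw [← hform U V w u hUw hV, hU.2 V hVmem, dualPairing_eq_inner hP hf hV]
  have hbij := bijective_of_coercive B hα₀ hcoer
  refine ⟨?_, fun U hU => ⟨hU.1.1, ?_⟩⟩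
  · obtain ⟨w, hw⟩ := hbij.2 f
    obtain ⟨U, hUmem, hUw⟩ := exists_mem_of_lp hP w
    refine ⟨U, ⟨hUmem, fun V hV => ?_⟩, fun U' hU' => ?_⟩
    · obtain ⟨u, hu⟩ := exists_isEnergySeq hV
      rw [hform U V w u hUw hu, hw, dualPairing_eq_inner hP hf hu]
    · obtain ⟨w', hw'⟩ := exists_isEnergySeq hU'.1
      obtain rfl : w' = w := hbij.1 ((hsol hw' hU').trans hw.symm)
      exact hw'.unique hP hUw
  · obtain ⟨w, hw⟩ := exists_isEnergySeq hU.1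
    have hBw := hsol hw hU
    obtain ⟨κ, hκ, hκ0, hcomm⟩ := exists_commutator_kernel P hs hN hdecay
    have hreg := summable_weighted_of_apply B (hasSum_matrix_apply B) hκ hκ0
      Subtype.val_injective hα₀ hcoer (p := fun k => ‖projFreq P k‖)
      (fun k => norm_nonneg _) hs
      (fun M hM k l => (mul_le_mul_of_nonneg_left (hmat k l) (abs_nonneg _)).trans
        (hcomm M hM k l)) w (by
        rw [hBw]
        -- Here `|P k|^(s+1) |f k| = |P k|^s |F k|`; dually, the conclusion uses `|P k|^(s+1) |w k|
        -- = |P k|^(s+2) |U k|`.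
        refine hFs.2.congr fun k => ?_
        rw [hf, norm_mul, norm_inv, Complex.norm_real, norm_norm, ← mul_assoc,
          Real.rpow_add_one (hpos k).ne', mul_inv_cancel_right₀ (hpos k).ne', mul_pow,
          ← rpow_two_mul (norm_nonneg _)])
    refine hreg.congr fun k => ?_
    rw [hw.2, norm_mul, Complex.norm_real, norm_norm, ← mul_assoc,
      ← Real.rpow_add_one (hpos k).ne', mul_pow, ← rpow_two_mul (norm_nonneg _),
      add_assoc, one_add_one_eq_two]
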